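/- Let $q,n\in\mathbb N$, $Q=\{0,\dots,q-1\}$. A local rule $f:Q^n\to Q$ together with an offset $d\in\mathbb Z$ defines the cellular automaton (CA) $F_{f,d}:Q^{\mathbb Z}\to Q^{\mathbb Z}$, $F_{f,d}(c)_{i+d}=f(c_i,\dots,c_{i+n-1})$. The rule $f$ is *conservative* if $\sum_{k=0}^{p-1}F_{f,0}(c)_k=\sum_{k=0}^{p-1}c_k$ for every configuration $c\in Q^{\mathbb Z}$ with period $p\ge 1$. A *particle automaton* (PA) $G$ with states $Q$ consists of a neighborhood $N=\{-\ell,\dots,r\}$ ($\ell,r\ge 0$) and functions $g_s:Q^\ell\times Q^r\to (N\cup\{\dagger\})^s$, $s=1,\dots,q-1$. In a configuration $c$, cell $i$ holds $c_i$ particles, and the $k$-th of them ($1\le k\le c_i$) vanishes if $[g_{c_i}(c_{i-\ell},\dots,c_{i-1},c_{i+1},\dots,c_{i+r})]_k=\dagger$ and otherwise moves to cell $i+[g_{c_i}(c_{i-\ell},\dots,c_{i-1},c_{i+1},\dots,c_{i+r})]_k$. The global action of $G$ is $G(c)_i=\min\{q-1,\ \text{number of particles arriving at } i\}$ (particles that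 stay at $i$ included). A CA $F$ is a *projection* of $G$ if $F(c)=G(c)$ for all $c\in Q^{\mathbb Z}$. A cell $i$ *anticipates* in the configuration $c$ if it receives from other cells $t$ particles with $t+c_i>q-1$. The PA $G$ exhibits *anticipation* if some cell anticipates in some configuration. It exhibits a *global anticipatory cycle* if in some configuration there is a chain of particles $(p_m)_{m\in\mathbb N}$, located at pairwise different positions, such that for every $m$ the particle $p_m$ moves to the cell occupied (before the move) by $p_{m+1}$, and this cell anticipates. A property of PA is *intrinsic* to a CA $F$ if every PA of which $F$ is a projection has the property, and intrinsic to a local rule $f$ if it is intrinsic to $F_{f,d}$ for every offset $d\in\mathbb Z$. **Statement.** Let $f$ be a conservative local rule. Then anticipation is intrinsic to $f$ if and only if global anticipatory cycles are intrinsic to $f$. Moreover, the same equivalence holds for each offset separately: for every $d\in\mathbb Z$, anticipation is intrinsic to $F_{f,d}$ if and only if global anticipatory cycles are intrinsic to $F_{f,d}$. -/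

import Mathlib

/-- A (bi-infinite) configuration over the states `Q = {0, …, q-1}`. -/
abbrev Configuration (q : ℕ) : Type := ℤ → Fin q

/-- A local rule `f : Q^{0,…,n-1} → Q` of a one-dimensional cellular automaton. -/
abbrev LocalRule (q n : ℕ) : Type := (Fin n → Fin q) → Fin q

/-- The cellular automaton defined by the local rule `f` and the offset `d`:
`F(c)_{i+d} = f(c_i, …, c_{i+n-1})` for all `i`. -/
def LocalRule.toCA {q n : ℕ} (f : LocalRule q n) (d : ℤ) (c : Configuration q) :
    Configuration q :=
  fun j => f (fun k => c (j - d + (k : ℕ)))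

/-- A local rule is conservative if the sum of the states over a period of a periodic
configuration is preserved. This does not depend on the offset, and the offset `0` is used. -/
def LocalRule.IsConservative {q n : ℕ} (f : LocalRule q n) : Prop :=
  ∀ (c : Configuration q) (p : ℕ), 0 < p → (∀ i : ℤ, c (i + p) = c i) →
    ∑ k ∈ Finset.range p, (f.toCA 0 c (k : ℤ) : ℕ) = ∑ k ∈ Finset.range p, (c (k : ℤ) : ℕ)

/-- A particle automaton with states `{0, …, q-1}` and neighborhood `N = {-ℓ, …, r}`.
A cell in state `s` holds `s` particles; `g s u v` gives the displacement in `N` of each of them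
when the `ℓ` cells on the left read `u` and the `r` cells on the right read `v`.
The value `none` means that the particle vanishes. -/
structure ParticleAutomaton (q : ℕ) where
  ℓ : ℕ
  r : ℕ
  g : (s : Fin q) → (Fin ℓ → Fin q) → (Fin r → Fin q) → Fin (s : ℕ) →
    Option (Set.Icc (-(ℓ : ℤ)) (r : ℤ))

namespace ParticleAutomaton

/-- The particles of a configuration: pairs of a cell `j` and an index below `c_j`. -/
abbrev Particle {q : ℕ} (c : Configuration q) : Type := (j : ℤ) × Fin (c j : ℕ)

/-- The cell to which a particle moves (`none` if it vanishes). -/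
def dest {q : ℕ} (G : ParticleAutomaton q) (c : Configuration q) (a : Particle c) : Option ℤ :=
  Option.map (fun x : Set.Icc (-(G.ℓ : ℤ)) (G.r : ℤ) => a.1 + x.1)
    (G.g (c a.1) (fun k => c (a.1 - G.ℓ + (k : ℕ))) (fun k => c (a.1 + 1 + (k : ℕ))) a.2)

/-- Only finitely many particles can arrive at a given cell. -/
theorem finite_dest {q : ℕ} (G : ParticleAutomaton q) (c : Configuration q) (i : ℤ) :
    {a : Particle c | G.dest c a = some i}.Finite := by
  refine (((Finset.Icc (i - (G.r : ℤ)) (i + (G.ℓ : ℤ))).sigma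
      (fun j => (Finset.univ : Finset (Fin (c j : ℕ))))).finite_toSet).subset ?_
  intro a ha
  obtain ⟨x, -, hx⟩ := Option.map_eq_some_iff.1 (show Option.map _ _ = some i from ha)
  have h1 := x.2.1
  have h2 := x.2.2
  simp only [Finset.coe_sigma, Set.mem_sigma_iff, Finset.coe_Icc, Set.mem_Icc, Finset.coe_univ,
    Set.mem_univ, and_true]
  omega

/-- The number of particles arriving at cell `i` (those that stay there included). -/
noncomputable def arrivals {q : ℕ} (G : ParticleAutomaton q) (c : Configuration q) (i : ℤ) : ℕ :=
  {a : Particle c | G.dest c a = some i}.ncard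

/-- The number of particles that cell `i` receives from other cells. -/
noncomputable def received {q : ℕ} (G : ParticleAutomaton q) (c : Configuration q) (i : ℤ) : ℕ :=
  {a : Particle c | a.1 ≠ i ∧ G.dest c a = some i}.ncard

/-- The global action `G(c)_i = min {q-1, number of particles arriving at i}`. -/
noncomputable def act {q : ℕ} (G : ParticleAutomaton q) (c : Configuration q) : Configuration q :=
  fun i => ⟨min (q - 1) (G.arrivals c i), by have := (c i).isLt; omega⟩

/-- The map `F` is the projection of `G`: both act alike on every configuration. -/
def HasProjection {q : ℕ} (G : ParticleAutomaton q) (F : Configuration q → Configuration q) :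
    Prop :=
  ∀ c, F c = G.act c

/-- In the configuration `c`, the cell `i`, in state `s = c_i`, receives from other cells a number
`t` of particles with `t + s > q - 1`. -/
def AnticipatesAt {q : ℕ} (G : ParticleAutomaton q) (c : Configuration q) (i : ℤ) : Prop :=
  q - 1 < G.received c i + (c i : ℕ)

/-- `G` exhibits anticipation. -/
def HasAnticipation {q : ℕ} (G : ParticleAutomaton q) : Prop :=
  ∃ (c : Configuration q) (i : ℤ), G.AnticipatesAt c i

/-- `G` exhibits a global anticipatory cycle: in some configuration there is an infinite chain of
particles at pairwise different positions, each of them moving to the cell occupied by the next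
one, and each of these motions is anticipatory. -/
def HasGlobalAnticipatoryCycle {q : ℕ} (G : ParticleAutomaton q) : Prop :=
  ∃ (c : Configuration q) (a : ℕ → Particle c),
    Function.Injective (fun m => (a m).1) ∧
    ∀ m, G.dest c (a m) = some (a (m + 1)).1 ∧ G.AnticipatesAt c (a (m + 1)).1

end ParticleAutomaton

/-- Property `P` of particle automata is intrinsic to the cellular automaton `F`:
every particle automaton of which `F` is the projection has the property. -/
def IsIntrinsicToCA {q : ℕ} (P : ParticleAutomaton q → Prop)
    (F : Configuration q → Configuration q) : Prop :=
  ∀ G : ParticleAutomaton q, G.HasProjection F → P G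

/-- Property `P` of particle automata is intrinsic to the local rule `f`: with any offset,
`f` is not the projection of a particle automaton without the property. -/
def IsIntrinsicToRule {q n : ℕ} (P : ParticleAutomaton q → Prop) (f : LocalRule q n) : Prop :=
  ∀ d : ℤ, IsIntrinsicToCA P (f.toCA d)

/-!
A particle automaton `G` with a global anticipatory cycle exhibits anticipation. For the converse,
every particle automaton `G` without global anticipatory cycles that projects to a conservative
rule is turned into a particle automaton without anticipation that has the same projection.

Conservativity implies that at most `q - 1` particles arrive at any cell: in a periodic
configuration the total of the truncated numbers of arriving particles is the total number of
particles, so nothing is truncated, and periodic configurations are dense (`arrivals_le`).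

At an anticipating cell `j`, the arriving particles are matched with the particles of `j`, as many
as possible; at the other cells, the particles that stay are matched with themselves. This is the
partial injection `relay`, and at most `q - 1 - c j` of the particles arriving at `j` remain
unmatched (`ncard_relay_eq_none_le`). If all its paths that are not cyclic are finite, it can be
closed up to a permutation, the inverse `φ` of which sends every particle to the one matched with
it, or else to the end of its path (`exists_perm_closesUp`). Let every particle `p` move where `G`
moves `φ p`. The same number of particles arrives at each cell, since `φ` is a permutation. A
matched arrival at `j` has become the motion of a particle of `j`, so that it is no longer
received from another cell. Hence there is no anticipation (`exists_not_hasAnticipation`).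

An infinite path of `relay` yields a global anticipatory cycle by loop erasure
(`hasGlobalAnticipatoryCycle_of_path`). As the configurations form a compact space, there is a
uniform bound on the lengths of the paths (`exists_bound_relay`), which also excludes the paths
that are infinite backwards. Finally, the new motion is shift-equivariant and continuous, and by
compactness again it has a finite neighborhood (`exists_particleAutomaton`).
-/

/-! ### Closing up a partial injection -/

section PartialInjection

variable {P : Type*} {N : P → Option P}

/-- One step along a partial map, `none` meaning that the path has ended. -/
def pathStep (N : P → Option P) (o : Option P) : Option P := o.bind N

/-- The relation `φ x = y` for the permutation `φ` that sends every `x` to its preimage under the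
partial injection `N`, and sends the first element of a maximal `N`-path to the last one. -/
def ClosesUp (N : P → Option P) (x y : P) : Prop :=
  N y = some x ∨
    ((∀ z, N z ≠ some x) ∧ N y = none ∧ ∃ t, (pathStep N)^[t] (some x) = some y)

theorem iterate_pathStep_none (t : ℕ) : (pathStep N)^[t] none = none :=
  Function.iterate_fixed rfl t

theorem exists_of_iterate_pathStep_succ {t : ℕ} {o : Option P} {y : P}
    (h : (pathStep N)^[t + 1] o = some y) :
    ∃ z, (pathStep N)^[t] o = some z ∧ N z = some y := by
  rw [Function.iterate_succ_apply'] at h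
  exact Option.bind_eq_some_iff.1 h

theorem iterate_pathStep_inj (hN : ∀ x y z, N x = some z → N y = some z → x = y) (t : ℕ)
    {o o' : Option P} {z : P} (h : (pathStep N)^[t] o = some z)
    (h' : (pathStep N)^[t] o' = some z) : o = o' := by
  induction t generalizing z with
  | zero => exact h.trans h'.symm
  | succ t ih =>
    obtain ⟨a, ha, ha'⟩ := exists_of_iterate_pathStep_succ h
    obtain ⟨b, hb, hb'⟩ := exists_of_iterate_pathStep_succ h'
    obtain rfl := hN _ _ _ ha' hb'
    exact ih ha hb

/-- A path of a partial injection that neither ends nor returns to its start visits pairwise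
different elements. -/
theorem exists_injective_path (hN : ∀ x y z, N x = some z → N y = some z → x = y) {p : P}
    (h : ∀ t, 0 < t → (pathStep N)^[t] (some p) ≠ none ∧ (pathStep N)^[t] (some p) ≠ some p) :
    ∃ x : ℕ → P, Function.Injective x ∧ ∀ t, N (x t) = some (x (t + 1)) := by
  have hsome : ∀ t, ∃ y, (pathStep N)^[t] (some p) = some y := by
    intro t
    rcases Nat.eq_zero_or_pos t with rfl | ht
    · exact ⟨p, rfl⟩
    · exact Option.ne_none_iff_exists'.1 (h t ht).1
  choose x hx using hsome
  refine ⟨x, ?_, ?_⟩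
  · have key : ∀ s t, s < t → x s ≠ x t := by
      intro s t hst hxs
      have h1 : (pathStep N)^[s] ((pathStep N)^[t - s] (some p)) = some (x t) := by
        rw [← Function.iterate_add_apply, Nat.add_sub_cancel' hst.le, hx]
      have h2 := hx s
      rw [hxs] at h2
      exact (h (t - s) (by omega)).2 (iterate_pathStep_inj hN s h1 h2)
    intro s t hst
    by_contra hne
    rcases lt_or_gt_of_ne hne with hlt | hlt
    · exact key s t hlt hst
    · exact key t s hlt hst.symm
  · intro t
    have h1 := hx (t + 1)
    rw [Function.iterate_succ_apply', hx t] at h1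
    exact h1

theorem ClosesUp.right_unique (hN : ∀ x y z, N x = some z → N y = some z → x = y) {x y y' : P}
    (h : ClosesUp N x y) (h' : ClosesUp N x y') : y = y' := by
  rcases h with h | ⟨h1, h2, t, h3⟩ <;> rcases h' with h' | ⟨h1', h2', t', h3'⟩
  · exact hN _ _ _ h h'
  · exact absurd h (h1' y)
  · exact absurd h' (h1 y')
  · -- the last element of a path is unique, since the path is `none` after it
    have key : ∀ {s s' : ℕ} {a b : P}, (pathStep N)^[s] (some x) = some a → N a = none →
        (pathStep N)^[s'] (some x) = some b → s' ≤ s := by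
      intro s s' a b ha hna hb
      by_contra hlt
      have e : s' = (s' - s - 1) + (s + 1) := by omega
      rw [e, Function.iterate_add_apply, Function.iterate_succ_apply', ha] at hb
      have : pathStep N (some a) = none := hna
      rw [this, iterate_pathStep_none] at hb
      exact absurd hb (by simp)
    have e : t = t' := le_antisymm (key h3' h2' h3) (key h3 h2 h3')
    subst e
    exact Option.some.inj (h3.symm.trans h3')

theorem ClosesUp.left_unique (hN : ∀ x y z, N x = some z → N y = some z → x = y) {x x' y : P}
    (h : ClosesUp N x y) (h' : ClosesUp N x' y) : x = x' := by
  rcases h with h | ⟨h1, h2, t, h3⟩ <;> rcases h' with h' | ⟨h1', h2', t', h3'⟩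
  · exact Option.some.inj (h.symm.trans h')
  · simp [h] at h2'
  · simp [h'] at h2
  · have key : ∀ {a b : P} {s s' : ℕ}, (pathStep N)^[s] (some a) = some y →
        (pathStep N)^[s'] (some b) = some y → (∀ z, N z ≠ some a) → s' ≤ s := by
      intro a b s s' ha hb hna
      by_contra hlt
      obtain ⟨m, rfl⟩ : ∃ m, s' = s + (m + 1) := ⟨s' - s - 1, by omega⟩
      rw [Function.iterate_add_apply] at hb
      obtain ⟨z, -, hz⟩ := exists_of_iterate_pathStep_succ (iterate_pathStep_inj hN s hb ha)
      exact hna z hz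
    have e : t = t' := le_antisymm (key h3' h3 h1') (key h3 h3' h1)
    subst e
    exact Option.some.inj (iterate_pathStep_inj hN t h3 h3')

theorem iterate_pathStep_mul_of_return {T : ℕ} {x : P}
    (h : (pathStep N)^[T] (some x) = some x) (m : ℕ) :
    (pathStep N)^[T * m] (some x) = some x := by
  rw [Function.iterate_mul]
  exact Function.iterate_fixed h m

/-- A partial injection all of whose paths end or return within a bounded number of steps can be
closed up to a permutation. The uniform bound excludes paths without a first element. -/
theorem exists_perm_closesUp (hN : ∀ x y z, N x = some z → N y = some z → x = y) (K : ℕ)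
    (hK : ∀ x, ∃ T, 0 < T ∧ T ≤ K ∧
      ((pathStep N)^[T] (some x) = none ∨ (pathStep N)^[T] (some x) = some x)) :
    ∃ φ : Equiv.Perm P, ∀ x y, φ x = y ↔ ClosesUp N x y := by
  have htotal : ∀ x, ∃ y, ClosesUp N x y := by
    intro x
    by_cases hx : ∃ z, N z = some x
    · obtain ⟨z, hz⟩ := hx
      exact ⟨z, Or.inl hz⟩
    · push Not at hx
      obtain ⟨T, hT0, -, hT⟩ := hK x
      have hend : ∃ t, (pathStep N)^[t] (some x) = none := by
        refine ⟨T, hT.resolve_right fun h => ?_⟩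
        obtain ⟨m, rfl⟩ : ∃ m, T = m + 1 := ⟨T - 1, by omega⟩
        obtain ⟨z, -, hz⟩ := exists_of_iterate_pathStep_succ h
        exact hx z hz
      classical
      obtain ⟨m, hm⟩ : ∃ m, Nat.find hend = m + 1 := by
        refine Nat.exists_eq_succ_of_ne_zero fun h0 => ?_
        have := Nat.find_spec hend
        rw [h0] at this
        simp at this
      obtain ⟨y, hy⟩ := Option.ne_none_iff_exists'.1 (Nat.find_min hend (m := m) (by omega))
      have hlast := Nat.find_spec hend
      rw [hm, Function.iterate_succ_apply', hy] at hlast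
      exact ⟨y, Or.inr ⟨hx, hlast, m, hy⟩⟩
  choose φ hφ using htotal
  have hsurj : Function.Surjective φ := by
    intro y
    suffices h : ∃ x, ClosesUp N x y by
      obtain ⟨x, hx⟩ := h
      exact ⟨x, (hφ x).right_unique hN hx⟩
    cases hy : N y with
    | some x => exact ⟨x, Or.inl hy⟩
    | none =>
      by_contra hno
      push Not at hno
      -- otherwise the path ending in `y` could be prolonged backwards for ever
      have hback : ∀ t, ∃ x, (pathStep N)^[t] (some x) = some y := by
        intro t
        induction t with
        | zero => exact ⟨y, rfl⟩
        | succ t ih =>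
          obtain ⟨x, hx⟩ := ih
          by_cases hz : ∃ z, N z = some x
          · obtain ⟨z, hz⟩ := hz
            refine ⟨z, ?_⟩
            rw [Function.iterate_succ_apply]
            have : pathStep N (some z) = some x := hz
            rw [this, hx]
          · push Not at hz
            exact absurd (Or.inr ⟨hz, hy, t, hx⟩) (hno x)
      obtain ⟨x, hx⟩ := hback K
      obtain ⟨T, hT0, hTK, hT⟩ := hK x
      have hend : ∀ t, K < t → (pathStep N)^[t] (some x) = none := by
        intro t ht
        have e : t = (t - K - 1) + (K + 1) := by omega
        have : pathStep N (some y) = none := hy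
        rw [e, Function.iterate_add_apply, Function.iterate_succ_apply', hx, this,
          iterate_pathStep_none]
      rcases hT with hT | hT
      · have e : K = (K - T) + T := by omega
        rw [e, Function.iterate_add_apply, hT, iterate_pathStep_none] at hx
        simp at hx
      · have h1 := hend (T * (K + 1)) (by nlinarith)
        rw [iterate_pathStep_mul_of_return hT] at h1
        simp at h1
  have hinj : Function.Injective φ := fun x x' h =>
    (hφ x).left_unique hN (h ▸ hφ x')
  exact ⟨Equiv.ofBijective φ ⟨hinj, hsurj⟩, fun x y =>
    ⟨fun h => h ▸ hφ x, fun h => (hφ x).right_unique hN h⟩⟩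

end PartialInjection

/-! ### The space of configurations -/

section Configurations

open Filter Topology

variable {q : ℕ}

/-- The translate of a configuration by `i` cells. -/
def Configuration.shift (i : ℤ) (c : Configuration q) : Configuration q := fun j => c (j + i)

theorem eventually_apply_eq (c : Configuration q) (i : ℤ) : ∀ᶠ c' in 𝓝 c, c' i = c i := by
  have h := (continuous_apply i : Continuous fun c : Configuration q => c i).tendsto c
  rw [nhds_discrete (Fin q), tendsto_pure] at h
  exact h

theorem eventually_nhds_configuration {c : Configuration q} {p : Configuration q → Prop} :
    (∀ᶠ c' in 𝓝 c, p c') ↔ ∃ R : ℕ, ∀ c' : Configuration q,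
      (∀ i : ℤ, -(R : ℤ) ≤ i → i ≤ R → c' i = c i) → p c' := by
  constructor
  · intro h
    rw [nhds_pi, Filter.eventually_iff, Filter.mem_pi'] at h
    obtain ⟨I, t, ht, hI⟩ := h
    refine ⟨I.sup Int.natAbs, fun c' hc' => hI fun i hi => ?_⟩
    have h1 : i.natAbs ≤ I.sup Int.natAbs := Finset.le_sup (f := Int.natAbs) hi
    rw [hc' i (by omega) (by omega)]
    exact mem_of_mem_nhds (ht i)
  · rintro ⟨R, hR⟩
    have h : ∀ᶠ c' in 𝓝 c, ∀ i ∈ Finset.Icc (-(R : ℤ)) R, c' i = c i :=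
      (Filter.eventually_all_finset _).2 fun i _ => eventually_apply_eq c i
    filter_upwards [h] with c' hc'
    exact hR c' fun i h1 h2 => hc' i (Finset.mem_Icc.2 ⟨h1, h2⟩)

/-- On a compact space, local bounds give a uniform one. -/
theorem exists_uniform_bound {X : Type*} [TopologicalSpace X] [CompactSpace X]
    {Q : X → ℕ → Prop} (hmono : ∀ c K L, K ≤ L → Q c K → Q c L)
    (hloc : ∀ c, ∃ K, ∀ᶠ c' in 𝓝 c, Q c' K) : ∃ K, ∀ c, Q c K := by
  have h := isCompact_univ.induction_on (X := X) (p := fun s => ∃ K, ∀ c ∈ s, Q c K)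
    ⟨0, by simp⟩ (fun s t hst ⟨K, hK⟩ => ⟨K, fun c hc => hK c (hst hc)⟩)
    (fun s t ⟨K, hK⟩ ⟨L, hL⟩ => ⟨max K L, fun c hc => hc.elim
      (fun h => hmono c _ _ (le_max_left _ _) (hK c h))
      (fun h => hmono c _ _ (le_max_right _ _) (hL c h))⟩)
    (fun c _ => by
      obtain ⟨K, hK⟩ := hloc c
      exact ⟨_, mem_nhdsWithin_of_mem_nhds hK, K, fun c' hc' => hc'⟩)
  obtain ⟨K, hK⟩ := h
  exact ⟨K, fun c => hK c (Set.mem_univ c)⟩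

end Configurations

namespace ParticleAutomaton

open Filter Topology

variable {q : ℕ} (G : ParticleAutomaton q) (c : Configuration q)

/-! ### Particles as pairs of integers -/

/-- The displacement of the `k`-th particle of a cell in state `s` with context `u`, `v`; it is
`none` if that particle vanishes or if `s ≤ k`. -/
def displacement (s : Fin q) (u : Fin G.ℓ → Fin q) (v : Fin G.r → Fin q) (k : ℕ) : Option ℤ :=
  if h : k < (s : ℕ) then (G.g s u v ⟨k, h⟩).map Subtype.val else none

/-- The cell to which the particle with index `p.2` of the cell `p.1` moves. Particles of all
configurations are encoded here as pairs in `ℤ × ℕ`; the value is `none` on the pairs with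
`c p.1 ≤ p.2`, which do not stand for a particle of `c`. -/
def target (p : ℤ × ℕ) : Option ℤ :=
  (G.displacement (c p.1) (fun k => c (p.1 - G.ℓ + (k : ℕ))) (fun k => c (p.1 + 1 + (k : ℕ)))
    p.2).map (p.1 + ·)

variable {G c}

theorem dest_eq_target (a : Particle c) : G.dest c a = G.target c (a.1, (a.2 : ℕ)) := by
  simp [dest, target, displacement]

theorem of_target_eq_some {p : ℤ × ℕ} {j : ℤ} (h : G.target c p = some j) :
    p.2 < (c p.1 : ℕ) ∧ p.1 - G.ℓ ≤ j ∧ j ≤ p.1 + G.r := by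
  obtain ⟨x, hx, rfl⟩ := Option.map_eq_some_iff.1 h
  unfold displacement at hx
  split_ifs at hx with hlt
  obtain ⟨y, -, rfl⟩ := Option.map_eq_some_iff.1 hx
  have h1 := y.2.1
  have h2 := y.2.2
  exact ⟨hlt, by omega, by omega⟩

theorem target_shift (i : ℤ) (p : ℤ × ℕ) (j : ℤ) :
    G.target (c.shift i) p = some j ↔ G.target c (p.1 + i, p.2) = some (j + i) := by
  have h1 : ∀ k : ℕ, p.1 - (G.ℓ : ℤ) + k + i = p.1 + i - G.ℓ + k := fun k => by ring
  have h2 : ∀ k : ℕ, p.1 + 1 + (k : ℤ) + i = p.1 + i + 1 + k := fun k => by ring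
  have h3 : ∀ x : ℤ, p.1 + i + x = j + i ↔ p.1 + x = j := fun x => by omega
  simp only [target, Configuration.shift, h1, h2, Option.map_eq_some_iff, h3]

variable (G c)

theorem exists_target_box (j : ℤ) : ∃ B : Finset (ℤ × ℕ), ∀ (c : Configuration q) (p : ℤ × ℕ),
    G.target c p = some j → p ∈ B := by
  refine ⟨Finset.Icc (j - G.r) (j + G.ℓ) ×ˢ Finset.range q, fun c p h => ?_⟩
  have h1 := of_target_eq_some h
  have h2 := (c p.1).isLt
  rw [Finset.mem_product, Finset.mem_Icc, Finset.mem_range]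
  omega

theorem finite_target (j : ℤ) : {p | G.target c p = some j}.Finite := by
  obtain ⟨B, hB⟩ := G.exists_target_box j
  exact B.finite_toSet.subset fun p hp => hB c p hp

theorem eventually_target (p : ℤ × ℕ) : ∀ᶠ c' in 𝓝 c, G.target c' p = G.target c p := by
  have h : ∀ᶠ c' in 𝓝 c, ∀ i ∈ Finset.Icc (p.1 - (G.ℓ : ℤ)) (p.1 + G.r), c' i = c i :=
    (Filter.eventually_all_finset _).2 fun i _ => eventually_apply_eq c i
  filter_upwards [h] with c' hc'
  have h0 : c' p.1 = c p.1 := hc' _ (Finset.mem_Icc.2 ⟨by omega, by omega⟩)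
  have h1 : (fun k : Fin G.ℓ => c' (p.1 - G.ℓ + (k : ℕ)))
      = fun k : Fin G.ℓ => c (p.1 - G.ℓ + (k : ℕ)) :=
    funext fun k => hc' _ (Finset.mem_Icc.2 ⟨by omega, by omega⟩)
  have h2 : (fun k : Fin G.r => c' (p.1 + 1 + (k : ℕ)))
      = fun k : Fin G.r => c (p.1 + 1 + (k : ℕ)) :=
    funext fun k => hc' _ (Finset.mem_Icc.2 ⟨by omega, by omega⟩)
  rw [target, target, h0, h1, h2]

theorem eventually_target_eq_some_iff (j : ℤ) :
    ∀ᶠ c' in 𝓝 c, ∀ p, G.target c' p = some j ↔ G.target c p = some j := by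
  obtain ⟨B, hB⟩ := G.exists_target_box j
  have h : ∀ᶠ c' in 𝓝 c, ∀ p ∈ B, G.target c' p = G.target c p :=
    (Filter.eventually_all_finset _).2 fun p _ => G.eventually_target c p
  filter_upwards [h] with c' hc' p
  by_cases hp : p ∈ B
  · rw [hc' p hp]
  · exact iff_of_false (fun h => hp (hB _ _ h)) (fun h => hp (hB _ _ h))

theorem ncard_particles (s : Set ℤ) (j : ℤ) :
    {a : Particle c | a.1 ∈ s ∧ G.dest c a = some j}.ncard
      = {p : ℤ × ℕ | p.1 ∈ s ∧ G.target c p = some j}.ncard := by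
  refine Set.ncard_congr (fun a _ => (a.1, (a.2 : ℕ))) ?_ ?_ ?_
  · intro a ha
    exact ⟨ha.1, dest_eq_target a ▸ ha.2⟩
  · rintro ⟨i, k⟩ ⟨i', k'⟩ - - h
    obtain ⟨rfl, h2⟩ := Prod.mk.inj h
    exact congrArg (Sigma.mk i) (Fin.ext h2)
  · rintro ⟨i, k⟩ ⟨h1, h2⟩
    have h3 := (of_target_eq_some h2).1
    refine ⟨⟨i, ⟨k, h3⟩⟩, ⟨h1, ?_⟩, rfl⟩
    rw [dest_eq_target]
    exact h2

theorem arrivals_eq_ncard_target (j : ℤ) :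
    G.arrivals c j = {p | G.target c p = some j}.ncard := by
  simpa [arrivals] using G.ncard_particles c Set.univ j

theorem received_eq_ncard_target (j : ℤ) :
    G.received c j = {p : ℤ × ℕ | p.1 ≠ j ∧ G.target c p = some j}.ncard := by
  simpa [received] using G.ncard_particles c {j}ᶜ j

theorem ncard_translate (i : ℤ) (s : Set (ℤ × ℕ)) :
    {p : ℤ × ℕ | (p.1 + i, p.2) ∈ s}.ncard = s.ncard := by
  have h := Set.ncard_image_of_injective s
    ((Equiv.addRight (-i)).prodCongr (Equiv.refl ℕ)).injective
  rw [Equiv.image_eq_preimage_symm] at h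
  simpa [Set.preimage, Prod.map] using h

theorem arrivals_shift (i j : ℤ) : G.arrivals (c.shift i) j = G.arrivals c (j + i) := by
  rw [arrivals_eq_ncard_target, arrivals_eq_ncard_target,
    ← ncard_translate i {p | G.target c p = some (j + i)}]
  simp only [target_shift, Set.mem_ofPred_eq]

theorem received_shift (i j : ℤ) : G.received (c.shift i) j = G.received c (j + i) := by
  rw [received_eq_ncard_target, received_eq_ncard_target,
    ← ncard_translate i {p : ℤ × ℕ | p.1 ≠ j + i ∧ G.target c p = some (j + i)}]
  simp only [target_shift, Set.mem_ofPred_eq, ne_eq, add_left_inj]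

theorem eventually_arrivals (j : ℤ) : ∀ᶠ c' in 𝓝 c, G.arrivals c' j = G.arrivals c j := by
  filter_upwards [G.eventually_target_eq_some_iff c j] with c' hc'
  simp only [arrivals_eq_ncard_target, hc']

theorem eventually_anticipatesAt (j : ℤ) :
    ∀ᶠ c' in 𝓝 c, G.AnticipatesAt c' j ↔ G.AnticipatesAt c j := by
  filter_upwards [G.eventually_target_eq_some_iff c j, eventually_apply_eq c j] with c' hc' hj
  simp only [AnticipatesAt, received_eq_ncard_target, hc', hj]

theorem anticipatesAt_shift (i j : ℤ) :
    G.AnticipatesAt (c.shift i) j ↔ G.AnticipatesAt c (j + i) := by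
  rw [AnticipatesAt, AnticipatesAt, received_shift, Configuration.shift]

/-! ### Conservative rules do not overflow -/

variable {G c}

theorem shift_mul_of_periodic {p : ℕ} (hc : ∀ i : ℤ, c (i + p) = c i) (z : ℤ) :
    c.shift (z * p) = c := by
  have h : Function.Periodic c (p : ℤ) := hc
  exact funext fun j => h.int_mul z j

variable (G) in
/-- In a periodic configuration, the particles that arrive in a period are represented, modulo
the period, by particles of any window of the same length. -/
theorem sum_arrivals_le_of_periodic {p : ℕ} (hp : 0 < p) (hc : ∀ i : ℤ, c (i + p) = c i)
    (d : ℤ) :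
    ∑ k ∈ Finset.range p, G.arrivals c k ≤ ∑ k ∈ Finset.range p, (c ((k : ℤ) - d) : ℕ) := by
  have hp' : (p : ℤ) ≠ 0 := by omega
  have hS : ∑ k ∈ Finset.range p, G.arrivals c k =
      ((Finset.range p).sigma fun k => (G.finite_target c (k : ℤ)).toFinset).card := by
    rw [Finset.card_sigma]
    refine Finset.sum_congr rfl fun k _ => ?_
    rw [arrivals_eq_ncard_target, Set.ncard_eq_toFinset_card _ (G.finite_target c k)]
  have hT : ∑ k ∈ Finset.range p, (c ((k : ℤ) - d) : ℕ) =
      ((Finset.range p).sigma fun k => Finset.range (c ((k : ℤ) - d) : ℕ)).card := by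
    rw [Finset.card_sigma]
    simp
  rw [hS, hT]
  refine Finset.card_le_card_of_injOn
    (fun x => ⟨((x.2.1 + d) % p).toNat, x.2.2⟩) ?_ ?_
  · rintro ⟨k, i, m⟩ hx
    simp only [Finset.coe_sigma, Set.mem_sigma_iff, Finset.mem_coe, Finset.mem_range,
      Set.Finite.mem_toFinset, Set.mem_ofPred_eq] at hx ⊢
    have h0 := Int.emod_nonneg (i + d) hp'
    have h1 := Int.emod_lt_of_pos (i + d) (by omega : (0 : ℤ) < p)
    refine ⟨by omega, ?_⟩
    have h2 := (of_target_eq_some hx.2).1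
    rw [Int.toNat_of_nonneg h0]
    have h3 : (i + d) % p - d + (i + d) / p * p = i := by
      have := Int.emod_add_mul_ediv (i + d) p
      linarith
    have h4 := congrFun (shift_mul_of_periodic hc ((i + d) / p)) ((i + d) % p - d)
    rw [Configuration.shift, h3] at h4
    rwa [← h4]
  · rintro ⟨k, i, m⟩ hx ⟨k', i', m'⟩ hx' h
    simp only [Finset.coe_sigma, Set.mem_sigma_iff, Finset.mem_coe, Finset.mem_range,
      Set.Finite.mem_toFinset, Set.mem_ofPred_eq] at hx hx'
    obtain ⟨h1, h2⟩ := Sigma.mk.inj h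
    obtain rfl : m = m' := eq_of_heq h2
    have h0 := Int.emod_nonneg (i + d) hp'
    have h0' := Int.emod_nonneg (i' + d) hp'
    have h3 : (i + d) % p = (i' + d) % p := by
      dsimp only at h1
      omega
    obtain ⟨z, hz⟩ := Int.ModEq.dvd (Int.ModEq.symm h3)
    obtain rfl : i = i' + z * p := by linarith
    -- the two particles are translates by `z` periods, and so are their targets
    have h4 := target_shift (G := G) (c := c) (z * p) (i', m) k'
    rw [shift_mul_of_periodic hc] at h4
    have h5 := Option.some.inj (hx.2.symm.trans (h4.1 hx'.2))
    have h6 : z = 0 := by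
      by_contra hz0
      rcases lt_or_gt_of_ne hz0 with h | h <;> nlinarith
    subst h6
    obtain rfl : k = k' := by omega
    simp

theorem arrivals_le_of_periodic {n : ℕ} {f : LocalRule q n} (hf : f.IsConservative) {d : ℤ}
    (hG : G.HasProjection (f.toCA d)) {p : ℕ} (hp : 0 < p) (hc : ∀ i : ℤ, c (i + p) = c i) :
    G.arrivals c 0 ≤ q - 1 := by
  have hact : ∑ k ∈ Finset.range p, (G.act c k : ℕ)
      = ∑ k ∈ Finset.range p, (c ((k : ℤ) - d) : ℕ) := by
    rw [← hG c]
    have h := hf (c.shift (-d)) p hp fun i => by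
      simp only [Configuration.shift]
      rw [← hc (i + -d)]
      congr 1
      ring
    simp only [Configuration.shift, ← sub_eq_add_neg] at h
    rw [← h]
    refine Finset.sum_congr rfl fun k _ => ?_
    simp only [LocalRule.toCA]
    congr 3
    funext m
    congr 1
    ring
  by_contra! hlt
  have h0 : 0 < q := (Nat.zero_le _).trans_lt (c 0).isLt
  have hlt' : ∑ k ∈ Finset.range p, (G.act c k : ℕ) < ∑ k ∈ Finset.range p, G.arrivals c k := by
    refine Finset.sum_lt_sum (fun k _ => min_le_right _ _) ⟨0, Finset.mem_range.2 hp, ?_⟩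
    exact (min_le_left _ _).trans_lt (by simpa using hlt)
  have := G.sum_arrivals_le_of_periodic hp hc d
  omega

/-- A particle automaton that projects to a conservative rule never truncates: periodic
configurations are dense, and in them the numbers of particles balance. -/
theorem arrivals_le {n : ℕ} {f : LocalRule q n} (hf : f.IsConservative) {d : ℤ}
    (hG : G.HasProjection (f.toCA d)) (c : Configuration q) (i : ℤ) :
    G.arrivals c i ≤ q - 1 := by
  have h0 : ∀ c : Configuration q, G.arrivals c 0 ≤ q - 1 := by
    intro c
    obtain ⟨R, hR⟩ := eventually_nhds_configuration.1 (G.eventually_arrivals c 0)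
    rw [← hR (fun j => c ((j + R) % (2 * R + 1 : ℕ) - R)) fun j h1 h2 => ?_]
    · refine arrivals_le_of_periodic hf hG (p := 2 * R + 1) (by omega) fun j => ?_
      have : j + ((2 * R + 1 : ℕ) : ℤ) + R = j + R + ((2 * R + 1 : ℕ) : ℤ) := by ring
      simp only [this, Int.add_emod_right]
    · rw [Int.emod_eq_of_lt (by omega) (by push_cast; omega)]
      congr 1
      ring
  have h1 := h0 (c.shift i)
  rwa [arrivals_shift, zero_add] at h1

/-! ### The relay map -/

variable (G c)

/-- The number of particles that arrive at `j` and precede `p` in the lexicographic order. -/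
noncomputable def rank (j : ℤ) (p : ℤ × ℕ) : ℕ :=
  {p' : ℤ × ℕ | G.target c p' = some j ∧ (p'.1 < p.1 ∨ p'.1 = p.1 ∧ p'.2 < p.2)}.ncard

open Classical in
/-- The relay map. A particle that arrives at an anticipating cell `j` hands its motion over to a
particle of `j`, the one whose index is the rank of the arriving particle, as long as there is
one; at the other cells, the particles that stay are handed over to themselves. The value is
`none` for the particles that are not handed over. -/
noncomputable def relay (p : ℤ × ℕ) : Option (ℤ × ℕ) :=
  (G.target c p).bind fun j =>
    if G.AnticipatesAt c j then
      if G.rank c j p < (c j : ℕ) then some (j, G.rank c j p) else none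
    else if p.1 = j then some p else none

variable {G c}

theorem relay_eq_some_iff {p p' : ℤ × ℕ} :
    G.relay c p = some p' ↔ G.target c p = some p'.1 ∧
      (G.AnticipatesAt c p'.1 ∧ G.rank c p'.1 p = p'.2 ∧ p'.2 < (c p'.1 : ℕ) ∨
        ¬ G.AnticipatesAt c p'.1 ∧ p = p') := by
  obtain ⟨j, k⟩ := p'
  rw [relay, Option.bind_eq_some_iff]
  constructor
  · rintro ⟨i, h1, h2⟩
    split_ifs at h2 with hA hr hi
    · obtain ⟨rfl, rfl⟩ := Prod.mk.inj (Option.some.inj h2)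
      exact ⟨h1, Or.inl ⟨hA, rfl, hr⟩⟩
    · obtain rfl := Option.some.inj h2
      obtain rfl : j = i := hi
      exact ⟨h1, Or.inr ⟨hA, rfl⟩⟩
  · rintro ⟨h1, ⟨hA, h2, h3⟩ | ⟨hA, rfl⟩⟩
    · dsimp only at h1 h2 h3 hA
      exact ⟨j, h1, by rw [if_pos hA, if_pos (h2 ▸ h3), h2]⟩
    · exact ⟨j, h1, by rw [if_neg hA, if_pos rfl]⟩

theorem relay_eq_none {p : ℤ × ℕ} {j : ℤ} (h : G.target c p = some j)
    (hp : G.relay c p = none) :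
    G.AnticipatesAt c j ∧ (c j : ℕ) ≤ G.rank c j p ∨ ¬ G.AnticipatesAt c j ∧ p.1 ≠ j := by
  rw [relay, h, Option.bind_some] at hp
  split_ifs at hp with hA hr hi
  · exact Or.inl ⟨hA, not_lt.1 hr⟩
  · exact Or.inr ⟨hA, hi⟩

theorem rank_lt_rank {j : ℤ} {p p' : ℤ × ℕ} (h : G.target c p = some j)
    (hlt : p.1 < p'.1 ∨ p.1 = p'.1 ∧ p.2 < p'.2) : G.rank c j p < G.rank c j p' := by
  refine Set.ncard_lt_ncard (Set.ssubset_iff_of_subset ?_ |>.2 ⟨p, ⟨h, hlt⟩, ?_⟩)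
    ((G.finite_target c j).subset fun x hx => hx.1)
  · rintro x ⟨h1, h2⟩
    exact ⟨h1, by omega⟩
  · rintro ⟨-, h2⟩
    omega

theorem rank_injOn (j : ℤ) : Set.InjOn (G.rank c j) {p | G.target c p = some j} := by
  intro p hp p' hp' h
  by_contra hne
  have h1 : (p.1 < p'.1 ∨ p.1 = p'.1 ∧ p.2 < p'.2) ∨ (p'.1 < p.1 ∨ p'.1 = p.1 ∧ p'.2 < p.2) := by
    have : p.1 ≠ p'.1 ∨ p.2 ≠ p'.2 := by
      by_contra! h2
      exact hne (Prod.ext h2.1 h2.2)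
    omega
  rcases h1 with h1 | h1
  · exact (rank_lt_rank hp h1).ne h
  · exact (rank_lt_rank hp' h1).ne h.symm

theorem rank_lt_arrivals {j : ℤ} {p : ℤ × ℕ} (h : G.target c p = some j) :
    G.rank c j p < G.arrivals c j := by
  rw [arrivals_eq_ncard_target]
  refine Set.ncard_lt_ncard (Set.ssubset_iff_of_subset (fun x hx => hx.1) |>.2 ⟨p, h, ?_⟩)
    (G.finite_target c j)
  rintro ⟨-, h2⟩
  omega

theorem relay_injective (p₁ p₂ p' : ℤ × ℕ) (h₁ : G.relay c p₁ = some p')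
    (h₂ : G.relay c p₂ = some p') : p₁ = p₂ := by
  rw [relay_eq_some_iff] at h₁ h₂
  obtain ⟨h1, ⟨hA, h2, -⟩ | ⟨hA, rfl⟩⟩ := h₁ <;> obtain ⟨h1', ⟨hA', h2', -⟩ | ⟨hA', rfl⟩⟩ := h₂
  · exact rank_injOn p'.1 h1 h1' (h2.trans h2'.symm)
  · exact absurd hA hA'
  · exact absurd hA' hA
  · rfl

/-- The particles that arrive at `j` and are not handed over fit into `j` together with all
particles of `j`. -/
theorem ncard_relay_eq_none_le {j : ℤ} (h : G.arrivals c j ≤ q - 1) :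
    {p | G.target c p = some j ∧ G.relay c p = none}.ncard + (c j : ℕ) ≤ q - 1 := by
  have hc := (c j).isLt
  by_cases hA : G.AnticipatesAt c j
  · have h1 : {p | G.target c p = some j ∧ G.relay c p = none}.ncard
        ≤ (Finset.Ico (c j : ℕ) (G.arrivals c j) : Set ℕ).ncard := by
      refine Set.ncard_le_ncard_of_injOn (G.rank c j) (fun p hp => ?_)
        ((rank_injOn j).mono fun p hp => hp.1) (Finset.finite_toSet _)
      have h2 := rank_lt_arrivals hp.1
      have h3 := relay_eq_none hp.1 hp.2
      simp only [hA, not_true_eq_false, false_and, or_false, true_and] at h3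
      simpa using ⟨h3, h2⟩
    rw [Set.ncard_coe_finset, Nat.card_Ico] at h1
    omega
  · have h1 : {p | G.target c p = some j ∧ G.relay c p = none}.ncard ≤ G.received c j := by
      rw [received_eq_ncard_target]
      refine Set.ncard_le_ncard (fun p hp => ?_)
        ((G.finite_target c j).subset fun p hp => hp.2)
      have h3 := relay_eq_none hp.1 hp.2
      simp only [hA, not_false_eq_true, true_and, false_and, false_or] at h3
      exact ⟨h3, hp.1⟩
    rw [AnticipatesAt] at hA
    omega

theorem rank_shift (i j : ℤ) (p : ℤ × ℕ) :
    G.rank (c.shift i) j p = G.rank c (j + i) (p.1 + i, p.2) := by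
  rw [rank, rank, ← ncard_translate i {p' : ℤ × ℕ | G.target c p' = some (j + i) ∧
    (p'.1 < p.1 + i ∨ p'.1 = p.1 + i ∧ p'.2 < p.2)}]
  simp only [target_shift, Set.mem_ofPred_eq, add_lt_add_iff_right, add_left_inj]

/-- The translation of particles by `i` cells. -/
def translate (i : ℤ) : ℤ × ℕ ≃ ℤ × ℕ := (Equiv.addRight i).prodCongr (Equiv.refl ℕ)

theorem translate_apply (i : ℤ) (p : ℤ × ℕ) : translate i p = (p.1 + i, p.2) := rfl

theorem relay_shift_eq_some_iff (i : ℤ) (p p' : ℤ × ℕ) :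
    G.relay (c.shift i) p = some p' ↔ G.relay c (translate i p) = some (translate i p') := by
  simp only [relay_eq_some_iff, target_shift, anticipatesAt_shift, rank_shift,
    (translate i).apply_eq_iff_eq]
  rfl

theorem map_relay_shift (i : ℤ) (p : ℤ × ℕ) :
    (G.relay (c.shift i) p).map (translate i) = G.relay c (translate i p) := by
  ext p'
  obtain ⟨p', rfl⟩ := (translate i).surjective p'
  simp only [Option.map_eq_some_iff, ← relay_shift_eq_some_iff,
    (translate i).apply_eq_iff_eq, exists_eq_right]

theorem map_iterate_relay_shift (i : ℤ) (t : ℕ) (o : Option (ℤ × ℕ)) :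
    ((pathStep (G.relay (c.shift i)))^[t] o).map (translate i)
      = (pathStep (G.relay c))^[t] (o.map (translate i)) := by
  refine Function.Semiconj.iterate_right (f := Option.map (translate i)) (fun o => ?_) t o
  cases o with
  | none => rfl
  | some p => exact map_relay_shift i p

theorem iterate_relay_shift_eq_some_iff (i : ℤ) (t : ℕ) (p p' : ℤ × ℕ) :
    (pathStep (G.relay (c.shift i)))^[t] (some p) = some p'
      ↔ (pathStep (G.relay c))^[t] (some (translate i p)) = some (translate i p') := by
  rw [← Option.map_some, ← map_iterate_relay_shift, Option.map_eq_some_iff]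
  simp only [(translate i).apply_eq_iff_eq, exists_eq_right]

theorem iterate_relay_shift_eq_none_iff (i : ℤ) (t : ℕ) (p : ℤ × ℕ) :
    (pathStep (G.relay (c.shift i)))^[t] (some p) = none
      ↔ (pathStep (G.relay c))^[t] (some (translate i p)) = none := by
  rw [← Option.map_some, ← map_iterate_relay_shift, Option.map_eq_none_iff]

theorem closesUp_relay_shift (i : ℤ) (p p' : ℤ × ℕ) :
    ClosesUp (G.relay (c.shift i)) p p'
      ↔ ClosesUp (G.relay c) (translate i p) (translate i p') := by
  have h : G.relay (c.shift i) p' = none ↔ G.relay c (translate i p') = none :=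
    iterate_relay_shift_eq_none_iff i 1 p'
  rw [ClosesUp, ClosesUp, relay_shift_eq_some_iff, h]
  simp only [ne_eq, relay_shift_eq_some_iff, iterate_relay_shift_eq_some_iff,
    ← (translate i).forall_congr_right (q := fun z => ¬ G.relay c z = some (translate i p))]

variable (G c)

theorem eventually_relay (p : ℤ × ℕ) : ∀ᶠ c' in 𝓝 c, G.relay c' p = G.relay c p := by
  cases hj : G.target c p with
  | none =>
    filter_upwards [G.eventually_target c p] with c' h1
    rw [relay, relay, h1, hj]
    rfl
  | some j =>
    filter_upwards [G.eventually_target c p, G.eventually_target_eq_some_iff c j,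
      G.eventually_anticipatesAt c j, eventually_apply_eq c j] with c' h1 h2 h3 h4
    have h5 : G.rank c' j p = G.rank c j p := by simp only [rank, h2]
    rw [relay, relay, h1, hj]
    simp only [Option.bind_some, h4, h5]
    by_cases hA : G.AnticipatesAt c j
    · rw [if_pos hA, if_pos (h3.2 hA)]
    · rw [if_neg hA, if_neg (mt h3.1 hA)]

theorem eventually_iterate_relay (t : ℕ) (p : ℤ × ℕ) : ∀ᶠ c' in 𝓝 c,
    (pathStep (G.relay c'))^[t] (some p) = (pathStep (G.relay c))^[t] (some p) := by
  induction t with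
  | zero => simp
  | succ t ih =>
    cases hy : (pathStep (G.relay c))^[t] (some p) with
    | none =>
      filter_upwards [ih] with c' h
      rw [Function.iterate_succ_apply', Function.iterate_succ_apply', h, hy]
      rfl
    | some y =>
      filter_upwards [ih, G.eventually_relay c y] with c' h h'
      rw [Function.iterate_succ_apply', Function.iterate_succ_apply', h, hy]
      exact h'

theorem eventually_closesUp_relay {p p' : ℤ × ℕ} (h : ClosesUp (G.relay c) p p') :
    ∀ᶠ c' in 𝓝 c, ClosesUp (G.relay c') p p' := by
  rcases h with h | ⟨h1, h2, t, h3⟩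
  · filter_upwards [G.eventually_relay c p'] with c' h'
    exact Or.inl (h'.trans h)
  · obtain ⟨B, hB⟩ := G.exists_target_box p.1
    have h4 : ∀ᶠ c' in 𝓝 c, ∀ z ∈ B, G.relay c' z = G.relay c z :=
      (Filter.eventually_all_finset _).2 fun z _ => G.eventually_relay c z
    filter_upwards [h4, G.eventually_relay c p', G.eventually_iterate_relay c t p]
      with c' h5 h6 h7
    refine Or.inr ⟨fun z hz => ?_, h6.trans h2, t, h7.trans h3⟩
    have hzB := hB _ _ (relay_eq_some_iff.1 hz).1
    exact h1 z ((h5 z hzB).symm.trans hz)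

/-! ### Relay paths are bounded -/

variable {G c}

/-- Loop erasure: a walk that visits every cell finitely often contains, along its last visits,
a chain through pairwise different cells. -/
theorem exists_injective_subchain {A : Type*} (pos : ℕ → A)
    (hpos : ∀ a, {m | pos m = a}.Finite) :
    ∃ τ : ℕ → ℕ, Function.Injective (fun m => pos (τ m)) ∧
      ∀ m, pos (τ (m + 1)) = pos (τ m + 1) := by
  have hlast : ∀ n, ∃ t, pos t = pos n ∧ ∀ m, pos m = pos n → m ≤ t := by
    intro n
    obtain ⟨t, ht, hmax⟩ := (hpos (pos n)).exists_maximal ⟨n, rfl⟩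
    exact ⟨t, ht, fun m hm => (le_total m t).elim id fun h => hmax hm h⟩
  choose last hl1 hl2 using hlast
  let τ : ℕ → ℕ := fun m => Nat.rec (last 0) (fun _ t => last (t + 1)) m
  have hτ : ∀ m, τ (m + 1) = last (τ m + 1) := fun _ => rfl
  have hlt : ∀ m, τ m < τ (m + 1) := fun m => by
    rw [hτ]
    exact Nat.lt_of_succ_le (hl2 _ _ rfl)
  have hmax : ∀ m n, pos n = pos (τ m) → n ≤ τ m := by
    intro m n h
    cases m with
    | zero => exact hl2 _ _ (h.trans (hl1 0))
    | succ m => exact hl2 _ _ (h.trans (hl1 _))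
  have hmono : StrictMono τ := strictMono_nat_of_lt_succ hlt
  refine ⟨τ, fun m n h => hmono.injective ?_, fun m => hl1 _⟩
  exact le_antisymm (hmax n _ h) (hmax m _ h.symm)

/-- An infinite relay path would contain a global anticipatory cycle. -/
theorem hasGlobalAnticipatoryCycle_of_path {x : ℕ → ℤ × ℕ} (hx : Function.Injective x)
    (hrelay : ∀ t, G.relay c (x t) = some (x (t + 1))) : G.HasGlobalAnticipatoryCycle := by
  have htarget : ∀ t, G.target c (x t) = some (x (t + 1)).1 := fun t =>
    (relay_eq_some_iff.1 (hrelay t)).1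
  have hvalid : ∀ t, (x t).2 < (c (x t).1 : ℕ) := fun t => (of_target_eq_some (htarget t)).1
  have hant : ∀ t, G.AnticipatesAt c (x (t + 1)).1 := by
    intro t
    rcases (relay_eq_some_iff.1 (hrelay t)).2 with ⟨h, -⟩ | ⟨-, h⟩
    · exact h
    · exact absurd (hx h) (by omega)
  obtain ⟨τ, hinj, hτ⟩ := exists_injective_subchain (fun t => (x t).1) (by
    intro j
    refine Set.Finite.of_finite_image (f := x) ?_ hx.injOn
    refine (({j} : Finset ℤ) ×ˢ Finset.range q).finite_toSet.subset ?_
    rintro - ⟨t, ht, rfl⟩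
    have h1 := hvalid t
    have h2 := (c (x t).1).isLt
    simp only [Finset.coe_product, Set.mem_prod, Finset.mem_coe, Finset.mem_singleton,
      Finset.mem_range]
    exact ⟨ht, by omega⟩)
  refine ⟨c, fun m => ⟨(x (τ m)).1, ⟨(x (τ m)).2, hvalid _⟩⟩, hinj, fun m => ⟨?_, ?_⟩⟩
  · rw [dest_eq_target]
    exact (htarget (τ m)).trans (congrArg some (hτ m).symm)
  · have h := hant (τ m)
    rwa [← hτ m] at h

/-- Without global anticipatory cycles, the relay paths of all configurations end or return
within a common number of steps. -/
theorem exists_bound_relay (hG : ¬ G.HasGlobalAnticipatoryCycle) :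
    ∃ K, ∀ (c : Configuration q) (p : ℤ × ℕ), ∃ T, 0 < T ∧ T ≤ K ∧
      ((pathStep (G.relay c))^[T] (some p) = none ∨
        (pathStep (G.relay c))^[T] (some p) = some p) := by
  have hloc : ∀ k : ℕ, ∃ K, ∀ c : Configuration q, ∃ T, 0 < T ∧ T ≤ K ∧
      ((pathStep (G.relay c))^[T] (some (0, k)) = none ∨
        (pathStep (G.relay c))^[T] (some (0, k)) = some (0, k)) := by
    intro k
    refine exists_uniform_bound ?_ ?_
    · rintro c K L hKL ⟨T, h1, h2, h3⟩
      exact ⟨T, h1, h2.trans hKL, h3⟩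
    · intro c
      obtain ⟨T, hT0, hT⟩ : ∃ T, 0 < T ∧ ((pathStep (G.relay c))^[T] (some (0, k)) = none ∨
          (pathStep (G.relay c))^[T] (some (0, k)) = some (0, k)) := by
        by_contra! hno
        obtain ⟨x, hx, hx'⟩ := exists_injective_path relay_injective hno
        exact hG (hasGlobalAnticipatoryCycle_of_path hx hx')
      refine ⟨T, ?_⟩
      filter_upwards [G.eventually_iterate_relay c T (0, k)] with c' hc'
      exact ⟨T, hT0, le_rfl, by rwa [hc']⟩
  choose K hK using hloc
  refine ⟨(Finset.range q).sup K + 1, fun c p => ?_⟩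
  by_cases hp : p.2 < q
  · obtain ⟨T, h1, h2, h3⟩ := hK p.2 (c.shift p.1)
    have h4 : K p.2 ≤ (Finset.range q).sup K := Finset.le_sup (Finset.mem_range.2 hp)
    refine ⟨T, h1, by omega, ?_⟩
    rw [iterate_relay_shift_eq_none_iff, iterate_relay_shift_eq_some_iff] at h3
    simpa only [translate_apply, zero_add, Prod.mk.eta] using h3
  · refine ⟨1, one_pos, by omega, Or.inl ?_⟩
    have h1 : G.target c p = none := by
      by_contra hne
      obtain ⟨j, hj⟩ := Option.ne_none_iff_exists'.1 hne
      have h2 := (of_target_eq_some hj).1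
      have h3 := (c p.1).isLt
      omega
    change G.relay c p = none
    rw [relay, h1]
    rfl

/-! ### The relayed particle automaton -/

/-- A shift-equivariant motion of particles that depends continuously on the configuration is
carried out by a particle automaton. -/
theorem exists_particleAutomaton (m : Configuration q → ℤ × ℕ → Option ℤ)
    (hshift : ∀ c i p j, m (c.shift i) p = some j ↔ m c (translate i p) = some (j + i))
    (hloc : ∀ c p, ∀ᶠ c' in 𝓝 c, m c' p = m c p)
    (hvalid : ∀ c p j, m c p = some j → p.2 < (c p.1 : ℕ)) :
    ∃ G : ParticleAutomaton q, ∀ c p, G.target c p = m c p := by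
  obtain ⟨R, hR⟩ : ∃ R : ℕ, ∀ c : Configuration q,
      (∀ c' : Configuration q, (∀ i : ℤ, -(R : ℤ) ≤ i → i ≤ R → c' i = c i) →
        ∀ k < q, m c' (0, k) = m c (0, k)) ∧
      ∀ k < q, ∀ j, m c (0, k) = some j → -(R : ℤ) ≤ j ∧ j ≤ R := by
    refine exists_uniform_bound ?_ fun c => ?_
    · rintro c K L hKL ⟨h1, h2⟩
      refine ⟨fun c' hc' => h1 c' fun i _ _ => hc' i (by omega) (by omega), fun k hk j hj => ?_⟩
      have := h2 k hk j hj
      omega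
    · have h1 : ∀ᶠ c' in 𝓝 c, ∀ k ∈ Finset.range q, m c' (0, k) = m c (0, k) :=
        (Filter.eventually_all_finset _).2 fun k _ => hloc c (0, k)
      obtain ⟨R, hR⟩ := eventually_nhds_configuration.1 h1
      obtain ⟨S, hS⟩ : ∃ S : ℕ, ∀ k < q, ∀ j, m c (0, k) = some j → j.natAbs ≤ S := by
        refine ⟨(Finset.range q).sup fun k => ((m c (0, k)).getD 0).natAbs, fun k hk j hj => ?_⟩
        have := Finset.le_sup (f := fun k => ((m c (0, k)).getD 0).natAbs) (Finset.mem_range.2 hk)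
        simpa [hj] using this
      refine ⟨max R S, ?_⟩
      filter_upwards [eventually_nhds_configuration.2 ⟨R, fun c' hc' => hc'⟩] with c' hc'
      have h2 : ∀ k < q, m c' (0, k) = m c (0, k) := fun k hk =>
        hR c' (fun i h1 h2 => hc' i h1 h2) k (Finset.mem_range.2 hk)
      refine ⟨fun c'' hc'' k hk => ?_, fun k hk j hj => ?_⟩
      · rw [h2 k hk]
        refine hR c'' (fun i h3 h4 => ?_) k (Finset.mem_range.2 hk)
        rw [hc'' i (by omega) (by omega), hc' i h3 h4]
      · rw [h2 k hk] at hj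
        have := hS k hk j hj
        omega
  -- the configuration that reads `u`, `s`, `v` around the origin, and `s` elsewhere
  let fill : (s : Fin q) → (Fin R → Fin q) → (Fin R → Fin q) → Configuration q :=
    fun s u v i => if h : -(R : ℤ) ≤ i ∧ i < 0 then u ⟨(i + R).toNat, by omega⟩
      else if h : 0 < i ∧ i ≤ R then v ⟨(i - 1).toNat, by omega⟩ else s
  refine ⟨⟨R, R, fun s u v k => (m (fill s u v) (0, k)).bind fun x =>
    if h : x ∈ Set.Icc (-(R : ℤ)) (R : ℤ) then some ⟨x, h⟩ else none⟩, fun c p => ?_⟩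
  by_cases hp : p.2 < (c p.1 : ℕ)
  · have hq : p.2 < q := hp.trans (c p.1).isLt
    have hfill : m (fill (c p.1) (fun k => c (p.1 - R + (k : ℕ))) (fun k => c (p.1 + 1 + (k : ℕ))))
        (0, p.2) = m (c.shift p.1) (0, p.2) := by
      refine (hR _).1 _ (fun i h1 h2 => ?_) _ hq
      simp only [fill, Configuration.shift]
      split_ifs with h3 h4
      · congr 1
        omega
      · congr 1
        omega
      · congr 1
        omega
    simp only [target, displacement, hp, dif_pos, hfill]
    have hs := hshift c p.1 (0, p.2)
    simp only [translate_apply, zero_add, Prod.mk.eta] at hs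
    ext j
    have hj := hs (j - p.1)
    rw [sub_add_cancel] at hj
    rw [← hj]
    simp only [Option.map_eq_some_iff, Option.bind_eq_some_iff]
    constructor
    · rintro ⟨x, ⟨y, ⟨z, hz, hzy⟩, rfl⟩, rfl⟩
      split_ifs at hzy with hmem
      obtain rfl := Option.some.inj hzy
      rw [hz, add_sub_cancel_left]
    · intro h
      have hmem := (hR _).2 _ hq _ h
      exact ⟨j - p.1, ⟨⟨j - p.1, hmem⟩, ⟨j - p.1, h, dif_pos hmem⟩, rfl⟩, by ring⟩
  · have h1 : m c p = none := by
      by_contra hne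
      obtain ⟨j, hj⟩ := Option.ne_none_iff_exists'.1 hne
      exact hp (hvalid _ _ _ hj)
    simp [target, displacement, hp, h1]

/-- Exchanging the motions of the particles along closed-up relay paths removes all anticipation
and does not change the numbers of arriving particles. -/
theorem exists_not_hasAnticipation (hG : ¬ G.HasGlobalAnticipatoryCycle)
    (harr : ∀ c i, G.arrivals c i ≤ q - 1) :
    ∃ G' : ParticleAutomaton q, ¬ G'.HasAnticipation ∧
      ∀ c i, G'.arrivals c i = G.arrivals c i := by
  obtain ⟨K, hK⟩ := exists_bound_relay hG
  choose φ hφ using fun c => exists_perm_closesUp (N := G.relay c) relay_injective K (hK c)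
  have hφshift : ∀ c i p, φ c (translate i p) = translate i (φ (c.shift i) p) := by
    intro c i p
    rw [hφ, ← closesUp_relay_shift, ← hφ]
  have hφloc : ∀ c p, ∀ᶠ c' in 𝓝 c, φ c' p = φ c p := by
    intro c p
    filter_upwards [G.eventually_closesUp_relay c ((hφ c p _).1 rfl)] with c' h
    exact (hφ c' p _).2 h
  have hmotion : ∃ G' : ParticleAutomaton q, ∀ c p, G'.target c p = G.target c (φ c p) := by
    refine exists_particleAutomaton (fun c p => G.target c (φ c p)) ?_ ?_ ?_
    · intro c i p j
      rw [target_shift, hφshift]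
      rfl
    · intro c p
      filter_upwards [hφloc c p, G.eventually_target c (φ c p)] with c' h1 h2
      rw [h1, h2]
    · intro c p j hj
      rcases (hφ c p _).1 rfl with h | ⟨-, h, t, ht⟩
      · obtain ⟨h1, ⟨-, -, h2⟩ | ⟨-, h2⟩⟩ := relay_eq_some_iff.1 h
        · exact h2
        · rw [h2] at hj
          exact h2 ▸ (of_target_eq_some hj).1
      · rcases t with _ | t
        · have h1 : p = φ c p := Option.some.inj ht
          rw [← h1] at hj
          exact (of_target_eq_some hj).1
        · by_contra hp
          have h1 : G.relay c p = none := by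
            by_contra hne
            obtain ⟨z, hz⟩ := Option.ne_none_iff_exists'.1 hne
            exact hp (of_target_eq_some (relay_eq_some_iff.1 hz).1).1
          have h2 : pathStep (G.relay c) (some p) = none := h1
          rw [Function.iterate_succ_apply, h2, iterate_pathStep_none] at ht
          simp at ht
  obtain ⟨G', hG'⟩ := hmotion
  refine ⟨G', ?_, fun c i => ?_⟩
  · rintro ⟨c, j, hA⟩
    have h1 : G'.received c j ≤ {p | G.target c p = some j ∧ G.relay c p = none}.ncard := by
      rw [received_eq_ncard_target]
      refine Set.ncard_le_ncard_of_injOn (φ c) ?_ (φ c).injective.injOn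
        ((G.finite_target c j).subset fun p hp => hp.1)
      rintro p ⟨hp, hj⟩
      rw [hG'] at hj
      refine ⟨hj, ?_⟩
      -- if `φ c p` were handed over, then to `p`; but it moves to `j`, which is not the cell of `p`
      by_contra hne
      obtain ⟨z, hz⟩ := Option.ne_none_iff_exists'.1 hne
      have h2 : z = p := (φ c).injective ((hφ c z _).2 (Or.inl hz))
      have h3 := (relay_eq_some_iff.1 hz).1
      rw [h2] at h3
      exact hp (Option.some.inj (h3.symm.trans hj))
    have h2 := ncard_relay_eq_none_le (harr c j)
    rw [AnticipatesAt] at hA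
    omega
  · rw [arrivals_eq_ncard_target, arrivals_eq_ncard_target]
    simp only [hG']
    exact Set.ncard_preimage_of_injective_subset_range (s := {p | G.target c p = some i})
      (φ c).injective (by simp)

end ParticleAutomaton

/-! ### Anticipation and global anticipatory cycles -/

theorem isIntrinsicToCA_hasAnticipation_iff {q n : ℕ} {f : LocalRule q n}
    (hf : f.IsConservative) (d : ℤ) :
    IsIntrinsicToCA ParticleAutomaton.HasAnticipation (f.toCA d) ↔
      IsIntrinsicToCA ParticleAutomaton.HasGlobalAnticipatoryCycle (f.toCA d) := by
  constructor
  · intro h G hG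
    by_contra hcyc
    obtain ⟨G', hG', harr⟩ := ParticleAutomaton.exists_not_hasAnticipation hcyc
      (ParticleAutomaton.arrivals_le hf hG)
    refine hG' (h G' fun c => (hG c).trans ?_)
    funext i
    simp only [ParticleAutomaton.act, harr]
  · intro h G hG
    obtain ⟨c, a, -, ha⟩ := h G hG
    exact ⟨c, _, (ha 0).2⟩

theorem mainTheorem5 {q n : ℕ} (f : LocalRule q n) (hf : f.IsConservative) :
    (IsIntrinsicToRule ParticleAutomaton.HasAnticipation f ↔
      IsIntrinsicToRule ParticleAutomaton.HasGlobalAnticipatoryCycle f) ∧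
    ∀ d : ℤ, (IsIntrinsicToCA ParticleAutomaton.HasAnticipation (f.toCA d) ↔
      IsIntrinsicToCA ParticleAutomaton.HasGlobalAnticipatoryCycle (f.toCA d)) :=
  ⟨forall_congr' fun d => isIntrinsicToCA_hasAnticipation_iff hf d,
    fun d => isIntrinsicToCA_hasAnticipation_iff hf d⟩
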